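/- For a quaternion $q=t+xi+yj+zk$ let $\widetilde q=t+xi-yj+zk$ (reversion), applied entrywise to quaternionic matrices. Let $$\mathfrak{so}^*(4)=\{A\in\mathfrak{sl}(2,\mathbb H): -\widetilde A^{\mathsf T}=A\},\qquad SO^*(4)=\{O\in SL(2,\mathbb H):\widetilde O^{\mathsf T}O=\mathbb I_2\},$$ where $\mathfrak{sl}(2,\mathbb H)$ consists of the quaternionic $2\times2$ matrices whose trace has real part $0$, and $SL(2,\mathbb H)$ of those with Study determinant $1$ (the determinant of the complex $4\times4$ matrix obtained from $t+xi+yj+zk\mapsto\begin{pmatrix}t+zi&ix-y\\ ix+y&t-zi\end{pmatrix}$). (a) There are a basis $S_1,\dots,S_6$ of $\mathfrak{su}(2)\oplus\mathfrak{sl}(2,\mathbb R)$ and a basis $A_1,\dots,A_6$ of $\mathfrak{so}^*(4)$ with, for all real $\theta_1,\dots,\theta_6$, $$\sum_i\theta_iS_i=\left(\tfrac12\begin{pmatrix}i\theta_3&-\theta_2+i\theta_1\\ \theta_2+i\theta_1&-i\theta_3\end{pmatrix},\ \tfrac12\begin{pmatrix}-\theta_6&-\theta_4-\theta_5\\ \theta_5-\theta_4&\theta_6\end{pmatrix}\right),$$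 $$\sum_i\theta_iA_i=\tfrac12\begin{pmatrix}(\theta_2+\theta_5)j&\theta_1+\theta_4i-\theta_3j+\theta_6k\\ -\theta_1-\theta_4i-\theta_3j-\theta_6k&(-\theta_2+\theta_5)j\end{pmatrix},$$ and the linear map $\sigma$ with $\sigma(S_i)=A_i$ is an isomorphism of real Lie algebras $\mathfrak{su}(2)\oplus\mathfrak{sl}(2,\mathbb R)\cong\mathfrak{so}^*(4)$. (b) There is a group homomorphism $\Phi:SU(2)\times SL(2,\mathbb R)\to SO^*(4)$ induced by $\sigma$, that is, $\Phi(\exp X,\exp Y)=\exp\sigma(X,Y)$ for all $X\in\mathfrak{su}(2)$, $Y\in\mathfrak{sl}(2,\mathbb R)$. It is a surjective covering map all of whose fibres have exactly two elements, and its kernel is $\{(\mathbb I,\mathbb I),(-\mathbb I,-\mathbb I)\}\cong\mathbb Z_2$, while $\Phi(-\mathbb I,\mathbb I)=\Phi(\mathbb I,-\mathbb I)=-\mathbb I$. It therefore induces an isomorphism of topological groups $$\bigl(SU(2)\times SL(2,\mathbb R)\bigr)/\mathbb Z_2\;\cong\;SO^*(4).$$ -/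

import Mathlib

open scoped Matrix Quaternion

-- The commutator bracket on an associative ring, as in Mathlib's own files on matrix Lie algebras.
attribute [local instance 100] LieRing.ofAssociativeRing

noncomputable section

namespace QuatOrth

/-- The quaternion `t + xi + yj + zk`. -/
def quat (t x y z : ℝ) : ℍ[ℝ] := ⟨t, x, y, z⟩

@[simp] theorem quat_re (t x y z : ℝ) : (quat t x y z).re = t := rfl

@[simp] theorem quat_imI (t x y z : ℝ) : (quat t x y z).imI = x := rfl

@[simp] theorem quat_imJ (t x y z : ℝ) : (quat t x y z).imJ = y := rfl

@[simp] theorem quat_imK (t x y z : ℝ) : (quat t x y z).imK = z := rfl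

/-- Quaternion reversion: conjugation of the `j` component only. -/
def reversion (q : ℍ[ℝ]) : ℍ[ℝ] := quat q.re q.imI (-q.imJ) q.imK

@[simp] theorem reversion_re (q : ℍ[ℝ]) : (reversion q).re = q.re := rfl

@[simp] theorem reversion_imI (q : ℍ[ℝ]) : (reversion q).imI = q.imI := rfl

@[simp] theorem reversion_imJ (q : ℍ[ℝ]) : (reversion q).imJ = -q.imJ := rfl

@[simp] theorem reversion_imK (q : ℍ[ℝ]) : (reversion q).imK = q.imK := rfl

theorem reversion_mul (p q : ℍ[ℝ]) : reversion (p * q) = reversion q * reversion p := by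
  ext <;> simp <;> ring

theorem reversion_add (p q : ℍ[ℝ]) : reversion (p + q) = reversion p + reversion q := by
  ext <;> simp; ring

theorem reversion_smul (c : ℝ) (q : ℍ[ℝ]) : reversion (c • q) = c • reversion q := by
  ext <;> simp

theorem reversion_zero : reversion 0 = 0 := by
  ext <;> simp

theorem reversion_one : reversion 1 = 1 := by
  ext <;> simp

/-- Reversion as an additive map. -/
def reversionHom : ℍ[ℝ] →+ ℍ[ℝ] where
  toFun := reversion
  map_zero' := reversion_zero
  map_add' := reversion_add

/-- The reversion-transpose of a quaternionic matrix. -/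
def revTranspose {n : ℕ} (A : Matrix (Fin n) (Fin n) ℍ[ℝ]) : Matrix (Fin n) (Fin n) ℍ[ℝ] :=
  (A.map reversion)ᵀ

theorem revTranspose_mul {n : ℕ} (A B : Matrix (Fin n) (Fin n) ℍ[ℝ]) :
    revTranspose (A * B) = revTranspose B * revTranspose A := by
  ext1 i j
  change reversionHom ((A * B) j i) = _
  simp only [Matrix.mul_apply, map_sum]
  exact Finset.sum_congr rfl fun k _ => reversion_mul _ _

theorem revTranspose_add {n : ℕ} (A B : Matrix (Fin n) (Fin n) ℍ[ℝ]) :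
    revTranspose (A + B) = revTranspose A + revTranspose B := by
  ext1 i j
  exact reversion_add _ _

theorem revTranspose_smul {n : ℕ} (c : ℝ) (A : Matrix (Fin n) (Fin n) ℍ[ℝ]) :
    revTranspose (c • A) = c • revTranspose A := by
  ext1 i j
  exact reversion_smul _ _

theorem revTranspose_zero {n : ℕ} : revTranspose (0 : Matrix (Fin n) (Fin n) ℍ[ℝ]) = 0 := by
  ext1 i j
  exact reversion_zero

theorem revTranspose_one {n : ℕ} : revTranspose (1 : Matrix (Fin n) (Fin n) ℍ[ℝ]) = 1 := by
  ext1 i j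
  by_cases h : i = j
  · subst h
    simp [revTranspose, reversion_one]
  · simp [revTranspose, Matrix.one_apply_ne h, Matrix.one_apply_ne (Ne.symm h), reversion_zero]

/-- The standard embedding `ℍ → M₂(ℂ)`,
`t + xi + yj + zk ↦ !![t + z i, i x - y; i x + y, t - z i]`. -/
def quatToComplex : ℍ[ℝ] →+* Matrix (Fin 2) (Fin 2) ℂ where
  toFun q := !![q.re + q.imK * Complex.I, Complex.I * q.imI - q.imJ;
    Complex.I * q.imI + q.imJ, q.re - q.imK * Complex.I]
  map_one' := by
    ext i j; fin_cases i <;> fin_cases j <;> simp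
  map_zero' := by
    ext i j; fin_cases i <;> fin_cases j <;> simp
  map_add' p q := by
    ext i j; fin_cases i <;> fin_cases j <;> simp <;> ring
  map_mul' p q := by
    ext i j
    fin_cases i <;> fin_cases j <;> simp [Matrix.mul_apply, Complex.ext_iff] <;>
      constructor <;> ring

/-- The embedding `M_n(ℍ) → M_{2n}(ℂ)` given by `quatToComplex` blockwise; the index set of
the `2n` rows and columns is `Fin n × Fin 2`. -/
def matrixToComplex (n : ℕ) :
    Matrix (Fin n) (Fin n) ℍ[ℝ] →+* Matrix (Fin n × Fin 2) (Fin n × Fin 2) ℂ :=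
  (Matrix.compRingEquiv (Fin n) (Fin 2) ℂ).toRingHom.comp quatToComplex.mapMatrix

/-- The Study determinant of a quaternionic matrix. -/
def studyDet (n : ℕ) : Matrix (Fin n) (Fin n) ℍ[ℝ] →* ℂ :=
  Matrix.detMonoidHom.comp (matrixToComplex n).toMonoidHom

/-- `SL(n, ℍ)`, inside `GL(n, ℍ)` (the units of `M_n(ℍ)`, with their usual topology). -/
def SLH (n : ℕ) : Subgroup (Matrix (Fin n) (Fin n) ℍ[ℝ])ˣ :=
  ((studyDet n).comp (Units.coeHom _)).ker

/-- `SO*(2n)`: the `O ∈ SL(n, ℍ)` with `Õᵀ O = 1`. -/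
def SOStar (n : ℕ) : Subgroup (Matrix (Fin n) (Fin n) ℍ[ℝ])ˣ where
  carrier := {O | O ∈ SLH n ∧ revTranspose O.val * O.val = 1}
  one_mem' := ⟨one_mem _, by simp [revTranspose_one]⟩
  mul_mem' {A B} hA hB := by
    refine ⟨mul_mem hA.1 hB.1, ?_⟩
    rw [Units.val_mul, revTranspose_mul, mul_assoc, ← mul_assoc _ A.val, hA.2, one_mul, hB.2]
  inv_mem' {A} hA := by
    refine ⟨inv_mem hA.1, ?_⟩
    have h : A⁻¹.val = revTranspose A.val := Units.inv_eq_of_mul_eq_one_left hA.2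
    have h2 : revTranspose A⁻¹.val * revTranspose A.val = 1 := by
      rw [← revTranspose_mul, Units.mul_inv, revTranspose_one]
    rwa [← h] at h2

/-- `so*(2n)`: the `A ∈ sl(n, ℍ)` with `-Ãᵀ = A`, where `sl(n, ℍ)` consists of the quaternionic
matrices whose trace is purely imaginary. -/
def soStar (n : ℕ) : LieSubalgebra ℝ (Matrix (Fin n) (Fin n) ℍ[ℝ]) where
  carrier := {A | A.trace.re = 0 ∧ -revTranspose A = A}
  zero_mem' := ⟨by simp, by simp [revTranspose_zero]⟩
  add_mem' {A B} hA hB := by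
    refine ⟨by simp [Matrix.trace_add, hA.1, hB.1], ?_⟩
    rw [revTranspose_add, neg_add, hA.2, hB.2]
  smul_mem' c A hA := by
    refine ⟨by simp [Matrix.trace_smul, hA.1], ?_⟩
    rw [revTranspose_smul, ← smul_neg, hA.2]
  lie_mem' {A B} hA hB := by
    have hA' : revTranspose A = -A := by rw [← hA.2, neg_neg, hA.2]
    have hB' : revTranspose B = -B := by rw [← hB.2, neg_neg, hB.2]
    refine ⟨?_, ?_⟩
    · have key : ∀ p q : ℍ[ℝ], (p * q).re = (q * p).re := fun p q => by simp; ring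
      have hre : ∀ f : Fin n → ℍ[ℝ], (∑ i, f i).re = ∑ i, (f i).re := fun f =>
        map_sum (⟨⟨fun q : ℍ[ℝ] => q.re, rfl⟩, fun _ _ => rfl⟩ : ℍ[ℝ] →+ ℝ) f Finset.univ
      change ((A * B - B * A).trace).re = 0
      rw [Matrix.trace_sub, Quaternion.re_sub, sub_eq_zero]
      simp only [Matrix.trace, Matrix.diag, Matrix.mul_apply, hre]
      rw [Finset.sum_comm]
      exact Finset.sum_congr rfl fun i _ => Finset.sum_congr rfl fun k _ => key _ _
    · change -revTranspose (A * B - B * A) = A * B - B * A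
      have hs : revTranspose (A * B - B * A) = revTranspose (A * B) - revTranspose (B * A) := by
        rw [eq_sub_iff_add_eq, ← revTranspose_add, sub_add_cancel]
      rw [hs, revTranspose_mul, revTranspose_mul, hA', hB']
      noncomm_ring

/-- `su(n)`: the trace-free anti-Hermitian complex matrices, as a real Lie algebra. -/
def su (n : ℕ) : LieSubalgebra ℝ (Matrix (Fin n) (Fin n) ℂ) where
  carrier := {X | X.trace = 0 ∧ -Xᴴ = X}
  zero_mem' := ⟨by simp, by simp⟩
  add_mem' {X Y} hX hY := by
    refine ⟨by simp [Matrix.trace_add, hX.1, hY.1], ?_⟩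
    rw [Matrix.conjTranspose_add, neg_add, hX.2, hY.2]
  smul_mem' c X hX := by
    refine ⟨by simp [Matrix.trace_smul, hX.1], ?_⟩
    rw [Matrix.conjTranspose_smul, star_trivial, ← smul_neg, hX.2]
  lie_mem' {X Y} hX hY := by
    have hX' : Xᴴ = -X := by rw [← hX.2, neg_neg, hX.2]
    have hY' : Yᴴ = -Y := by rw [← hY.2, neg_neg, hY.2]
    refine ⟨?_, ?_⟩
    · change (X * Y - Y * X).trace = 0
      rw [Matrix.trace_sub, Matrix.trace_mul_comm, sub_self]
    · change -(X * Y - Y * X)ᴴ = X * Y - Y * X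
      rw [Matrix.conjTranspose_sub, Matrix.conjTranspose_mul, Matrix.conjTranspose_mul, hX', hY']
      noncomm_ring

/-- The Lie algebra `sl(2, ℝ)`. -/
abbrev sl2R : LieSubalgebra ℝ (Matrix (Fin 2) (Fin 2) ℝ) := LieAlgebra.SpecialLinear.sl (Fin 2) ℝ

/-- The group `SU(2)`. -/
abbrev SU2 : Submonoid (Matrix (Fin 2) (Fin 2) ℂ) := Matrix.specialUnitaryGroup (Fin 2) ℂ

/-- The group `SL(2, ℝ)`. -/
abbrev SL2R : Type := Matrix.SpecialLinearGroup (Fin 2) ℝ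

/-- The general element of `so*(4)` in the basis `A₁, …, A₆`. -/
def soStarMatrix (θ₁ θ₂ θ₃ θ₄ θ₅ θ₆ : ℝ) : Matrix (Fin 2) (Fin 2) ℍ[ℝ] :=
  (1 / 2 : ℝ) • !![quat 0 0 (θ₂ + θ₅) 0, quat θ₁ θ₄ (-θ₃) θ₆;
    quat (-θ₁) (-θ₄) (-θ₃) (-θ₆), quat 0 0 (-θ₂ + θ₅) 0]

/-- The general element of `su(2)` in its standard basis. -/
def suMatrix (θ₁ θ₂ θ₃ : ℝ) : Matrix (Fin 2) (Fin 2) ℂ :=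
  (1 / 2 : ℝ) • !![Complex.I * θ₃, -θ₂ + Complex.I * θ₁;
    θ₂ + Complex.I * θ₁, -(Complex.I * θ₃)]

/-- The general element of `sl(2, ℝ)` in its standard basis. -/
def slMatrix (θ₄ θ₅ θ₆ : ℝ) : Matrix (Fin 2) (Fin 2) ℝ :=
  (1 / 2 : ℝ) • !![-θ₆, -θ₄ - θ₅; θ₅ - θ₄, θ₆]

/-- The diagonal `ℤ/2` in `SU(2) × SL(2, ℝ)`, consisting of `(1, 1)` and `(-1, -1)`. -/
def diagSign : Subgroup (SU2 × SL2R) where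
  carrier := {g | (g.1.val = 1 ∧ g.2.val = 1) ∨ (g.1.val = -1 ∧ g.2.val = -1)}
  one_mem' := Or.inl ⟨rfl, rfl⟩
  mul_mem' {g h} hg hh := by
    simp only [Set.mem_ofPred_eq, Prod.fst_mul, Prod.snd_mul, Submonoid.coe_mul,
      Matrix.SpecialLinearGroup.coe_mul] at *
    rcases hg with ⟨a, b⟩ | ⟨a, b⟩ <;> rcases hh with ⟨c, d⟩ | ⟨c, d⟩ <;> simp [a, b, c, d]
  inv_mem' {g} hg := by
    have h1 : (g⁻¹).1.val = star g.1.val := rfl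
    have h2 : (g⁻¹).2.val = g.2.val.adjugate := rfl
    simp only [Set.mem_ofPred_eq, h1, h2] at *
    rcases hg with ⟨a, b⟩ | ⟨a, b⟩
    · simp [a, b]
    · refine Or.inr ⟨by simp [a], ?_⟩
      rw [b]
      ext i j
      fin_cases i <;> fin_cases j <;> simp [Matrix.adjugate_fin_two]

instance diagSign_normal : diagSign.Normal where
  conj_mem n hn g := by
    have hc : g * n = n * g := by
      refine Prod.ext (Subtype.ext ?_) (Subtype.ext ?_)
      · change g.1.val * n.1.val = n.1.val * g.1.val
        rcases hn with ⟨a, -⟩ | ⟨a, -⟩ <;> simp [a]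
      · change g.2.val * n.2.val = n.2.val * g.2.val
        rcases hn with ⟨-, a⟩ | ⟨-, a⟩ <;> simp [a]
    rwa [hc, mul_inv_cancel_right]

end QuatOrth

end

open QuatOrth

noncomputable section

namespace QuatOrth

/-! Inside `M₂(ℍ)` the scalar quaternions `q` and the real matrices `M` commute with each other.
Unit quaternions form `SU(2)`, imaginary ones `su(2)`. The claim is that, after conjugation by the
fixed matrix `P = frame`, the group `SO*(4)` is exactly the set of products `q M` with `|q| = 1` and
`det M = 1`, and `so*(4)` is the set of sums `q + M` with `q` imaginary and `tr M = 0`.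

The reason is that `P P̃ᵀ = 4 j J` with `J = !![0, 1; -1, 0]`. Conjugation by `j` turns reversion
into quaternion conjugation, and conjugation by `J` turns the transpose into the adjugate, so
reversion-transpose becomes `conjAdjugate` (`revTranspose_frame_conj`), which sends `q M` to `q̄ adj
M`. Products `q M` as above therefore satisfy the defining equation. Conversely, the equation forces
all entries of the matrix to be real multiples of one quaternion (`star_entry_mul_comm`), so
dividing by the direction of a nonzero entry recovers `q` and `M`; this gives surjectivity.

Only the common sign of `q` and `M` is lost, hence the kernel. Near the identity the entry `(0, 0)`
stays nonzero, which yields a continuous local section; so the map is open, and an open quotient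
homomorphism with finite kernel is a covering. Compatibility with `exp` is `exp (q + M) = exp q *
exp M` for commuting `q` and `M`. -/

/-! ### Quaternions as complex matrices: `SU(2)` and `su(2)` -/

/-- The quaternion whose image under `quatToComplex` has the same first column as `g`. -/
def complexToQuat : Matrix (Fin 2) (Fin 2) ℂ →ₗ[ℝ] ℍ[ℝ] where
  toFun g := quat (g 0 0).re (g 1 0).im (g 1 0).re (g 0 0).im
  map_add' g h := by ext <;> simp
  map_smul' c g := by ext <;> simp

theorem complexToQuat_apply (g : Matrix (Fin 2) (Fin 2) ℂ) :
    complexToQuat g = quat (g 0 0).re (g 1 0).im (g 1 0).re (g 0 0).im := rfl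

@[simp] theorem complexToQuat_quatToComplex (q : ℍ[ℝ]) :
    complexToQuat (quatToComplex q) = q := by
  ext <;> simp [complexToQuat_apply, quatToComplex]

theorem quatToComplex_complexToQuat_of {g : Matrix (Fin 2) (Fin 2) ℂ}
    (h₁ : g 1 1 = star (g 0 0)) (h₂ : g 0 1 = -star (g 1 0)) :
    quatToComplex (complexToQuat g) = g := by
  ext i j
  fin_cases i <;> fin_cases j <;>
    simp [complexToQuat_apply, quatToComplex, h₁, h₂, Complex.ext_iff]

theorem det_quatToComplex (q : ℍ[ℝ]) :
    (quatToComplex q).det = (Quaternion.normSq q : ℝ) := by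
  rw [Complex.ext_iff]
  constructor
  · simp only [Complex.ofReal_re, Quaternion.normSq_def']
    simp [Matrix.det_fin_two, quatToComplex]
    ring
  · simp only [Complex.ofReal_im]
    simp [Matrix.det_fin_two, quatToComplex]
    ring

theorem star_quatToComplex (q : ℍ[ℝ]) : star (quatToComplex q) = quatToComplex (star q) := by
  ext i j
  fin_cases i <;> fin_cases j <;> simp [quatToComplex, Matrix.star_apply, Complex.ext_iff]

theorem quatToComplex_mem_SU2 {q : ℍ[ℝ]} (hq : Quaternion.normSq q = 1) :
    quatToComplex q ∈ SU2 := by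
  rw [Matrix.mem_specialUnitaryGroup_iff, Matrix.mem_unitaryGroup_iff, star_quatToComplex,
    ← map_mul, Quaternion.self_mul_star, det_quatToComplex, hq]
  simp

/-- For determinant one the inverse is the adjugate, for a unitary matrix it is the adjoint.
Equating the two shows that the first column determines the second in the way required of a
quaternion. -/
theorem quatToComplex_complexToQuat_SU2 (g : SU2) :
    quatToComplex (complexToQuat g.val) = g.val := by
  obtain ⟨hu, hd⟩ := Matrix.mem_specialUnitaryGroup_iff.1 g.2
  have hs : star g.val = g.val.adjugate := by
    have h1 : g.val * star g.val = 1 := Matrix.mem_unitaryGroup_iff.1 hu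
    have h2 : g.val.adjugate * g.val = 1 := by rw [Matrix.adjugate_mul, hd, one_smul]
    calc star g.val = (g.val.adjugate * g.val) * star g.val := by rw [h2, one_mul]
      _ = g.val.adjugate := by rw [mul_assoc, h1, mul_one]
  rw [Matrix.adjugate_fin_two] at hs
  have h00 := congrFun (congrFun hs 0) 0
  have h01 := congrFun (congrFun hs 0) 1
  simp [Matrix.star_apply] at h00 h01
  exact quatToComplex_complexToQuat_of (by simp [← h00]) (by simp [h01])

theorem normSq_complexToQuat_SU2 (g : SU2) :
    Quaternion.normSq (complexToQuat g.val) = 1 := by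
  have hd := (Matrix.mem_specialUnitaryGroup_iff.1 g.2).2
  rw [← quatToComplex_complexToQuat_SU2, det_quatToComplex] at hd
  exact_mod_cast hd

theorem mem_su_iff {X : Matrix (Fin 2) (Fin 2) ℂ} : X ∈ su 2 ↔ X.trace = 0 ∧ -Xᴴ = X := Iff.rfl

theorem quatToComplex_complexToQuat_su (X : su 2) :
    quatToComplex (complexToQuat X.val) = X.val := by
  obtain ⟨ht, hX⟩ := mem_su_iff.1 X.2
  have h00 := congrFun (congrFun hX 0) 0
  have h01 := congrFun (congrFun hX 0) 1
  rw [Matrix.trace_fin_two] at ht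
  simp [Matrix.conjTranspose_apply] at h00 h01
  refine quatToComplex_complexToQuat_of ?_ (by simp [h01])
  rw [eq_neg_of_add_eq_zero_right ht]
  nth_rw 1 [← h00]
  simp

theorem complexToQuat_su_re (X : su 2) : (complexToQuat X.val).re = 0 := by
  have h00 := congrFun (congrFun X.2.2 0) 0
  have := congrArg Complex.re h00
  simp [Matrix.conjTranspose_apply] at this
  simp only [complexToQuat_apply, quat_re]
  linarith

theorem complexToQuat_mul_SU2 (g h : SU2) :
    complexToQuat (g * h).val = complexToQuat g.val * complexToQuat h.val := by
  rw [Submonoid.coe_mul, ← quatToComplex_complexToQuat_SU2 g, ← quatToComplex_complexToQuat_SU2 h,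
    ← map_mul quatToComplex]
  simp only [complexToQuat_quatToComplex]

theorem complexToQuat_one : complexToQuat 1 = 1 := by
  rw [← map_one quatToComplex, complexToQuat_quatToComplex]

theorem complexToQuat_lie_su (X Y : su 2) :
    complexToQuat ⁅X, Y⁆.val =
      complexToQuat X.val * complexToQuat Y.val - complexToQuat Y.val * complexToQuat X.val := by
  have : ⁅X, Y⁆.val = X.val * Y.val - Y.val * X.val := rfl
  rw [this, ← quatToComplex_complexToQuat_su X, ← quatToComplex_complexToQuat_su Y,
    ← map_mul quatToComplex, ← map_mul quatToComplex, ← map_sub quatToComplex]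
  simp only [complexToQuat_quatToComplex]

/-! ### The commuting subalgebras `ℍ` and `M₂(ℝ)`, and their Study determinants -/

/-- Real matrices as quaternionic matrices. -/
def realToQuat : Matrix (Fin 2) (Fin 2) ℝ →ₐ[ℝ] Matrix (Fin 2) (Fin 2) ℍ[ℝ] :=
  (Algebra.ofId ℝ ℍ[ℝ]).mapMatrix

theorem realToQuat_apply (M : Matrix (Fin 2) (Fin 2) ℝ) (i j : Fin 2) :
    realToQuat M i j = (M i j : ℍ[ℝ]) := rfl

/-- Left multiplication by a quaternion, as a quaternionic matrix. -/
abbrev scalarQuat : ℍ[ℝ] →+* Matrix (Fin 2) (Fin 2) ℍ[ℝ] := Matrix.scalar (Fin 2)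

theorem scalarQuat_mul_realToQuat_apply (q : ℍ[ℝ]) (M : Matrix (Fin 2) (Fin 2) ℝ) (i j : Fin 2) :
    (scalarQuat q * realToQuat M) i j = q * (M i j : ℍ[ℝ]) := by
  simp [realToQuat_apply, Matrix.scalar_apply, Matrix.diagonal_mul]

theorem scalarQuat_commute_realToQuat (q : ℍ[ℝ]) (M : Matrix (Fin 2) (Fin 2) ℝ) :
    Commute (scalarQuat q) (realToQuat M) := by
  ext1 i j
  rw [scalarQuat_mul_realToQuat_apply]
  simp only [realToQuat_apply, Matrix.scalar_apply, Matrix.mul_diagonal]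
  exact (Quaternion.coe_commutes _ _).symm

theorem studyDet_scalarQuat (q : ℍ[ℝ]) :
    studyDet 2 (scalarQuat q) = ((Quaternion.normSq q : ℝ) : ℂ) ^ 2 := by
  have h : matrixToComplex 2 (scalarQuat q) =
      Matrix.kronecker (1 : Matrix (Fin 2) (Fin 2) ℂ) (quatToComplex q) := by
    ext ⟨i, a⟩ ⟨j, b⟩
    change quatToComplex (scalarQuat q i j) a b = _
    fin_cases i <;> fin_cases j <;> simp [Matrix.kronecker, Matrix.kroneckerMap_apply]
  change (matrixToComplex 2 (scalarQuat q)).det = _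
  rw [h, Matrix.kronecker, Matrix.det_kronecker, det_quatToComplex]
  simp

theorem studyDet_realToQuat (M : Matrix (Fin 2) (Fin 2) ℝ) :
    studyDet 2 (realToQuat M) = (M.det : ℂ) ^ 2 := by
  have h : matrixToComplex 2 (realToQuat M) =
      Matrix.kronecker (M.map Complex.ofRealHom) (1 : Matrix (Fin 2) (Fin 2) ℂ) := by
    ext ⟨i, a⟩ ⟨j, b⟩
    change quatToComplex (M i j : ℍ[ℝ]) a b = _
    fin_cases a <;> fin_cases b <;>
      simp [Matrix.kronecker, Matrix.kroneckerMap_apply, quatToComplex]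
  change (matrixToComplex 2 (realToQuat M)).det = _
  rw [h, Matrix.kronecker, Matrix.det_kronecker, ← RingHom.mapMatrix_apply, ← RingHom.map_det]
  simp

/-! ### The frame and the transported involution -/

/-- The change of basis that turns `SO*(4)` into the products of a unit quaternion and a matrix in
`SL(2, ℝ)`. -/
def frame : (Matrix (Fin 2) (Fin 2) ℍ[ℝ])ˣ where
  val := !![quat 1 0 1 0, quat 0 (-1) 0 (-1); quat 1 0 (-1) 0, quat 0 (-1) 0 1]
  inv := (1 / 4 : ℝ) • !![quat 1 0 (-1) 0, quat 1 0 1 0; quat 0 1 0 1, quat 0 1 0 (-1)]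
  val_inv := by
    ext1 i j
    fin_cases i <;> fin_cases j <;> ext <;> norm_num [Matrix.mul_apply, Fin.sum_univ_two]
  inv_val := by
    ext1 i j
    fin_cases i <;> fin_cases j <;> ext <;> norm_num [Matrix.mul_apply, Fin.sum_univ_two]

theorem frame_val : frame.val =
    !![quat 1 0 1 0, quat 0 (-1) 0 (-1); quat 1 0 (-1) 0, quat 0 (-1) 0 1] := rfl

/-- Quaternion conjugation combined with the adjugate of `2 × 2` matrices. -/
def conjAdjugate (X : Matrix (Fin 2) (Fin 2) ℍ[ℝ]) : Matrix (Fin 2) (Fin 2) ℍ[ℝ] :=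
  !![star (X 1 1), -star (X 0 1); -star (X 1 0), star (X 0 0)]

/-- This is the property for which the frame is chosen: the form becomes `4 j J`, a scalar
quaternion times the real symplectic matrix. -/
theorem frame_mul_revTranspose_frame :
    frame.val * revTranspose frame.val = !![0, quat 0 0 4 0; quat 0 0 (-4) 0, 0] := by
  ext1 i j
  fin_cases i <;> fin_cases j <;> ext <;>
    norm_num [Matrix.mul_apply, Fin.sum_univ_two, revTranspose, frame_val]

theorem revTranspose_frame_conj (X : Matrix (Fin 2) (Fin 2) ℍ[ℝ]) :
    revTranspose ((frame⁻¹).val * X * frame.val) =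
      (frame⁻¹).val * conjAdjugate X * frame.val := by
  -- Entrywise, `j q̃ = q̄ j`, while `J` turns the transpose into the adjugate.
  have h1 : frame.val * revTranspose frame.val * revTranspose X =
      conjAdjugate X * (frame.val * revTranspose frame.val) := by
    rw [frame_mul_revTranspose_frame]
    ext1 i j
    fin_cases i <;> fin_cases j <;> ext <;>
      simp [Matrix.mul_apply, Fin.sum_univ_two, revTranspose, conjAdjugate, mul_comm]
  have h2 : revTranspose frame.val * revTranspose (frame⁻¹).val = 1 := by
    rw [← revTranspose_mul, Units.inv_mul, revTranspose_one]
  calc revTranspose ((frame⁻¹).val * X * frame.val)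
      = (frame⁻¹).val * (frame.val * revTranspose frame.val * revTranspose X) *
          revTranspose (frame⁻¹).val := by
        simp only [revTranspose_mul, mul_assoc, Units.inv_mul_cancel_left]
    _ = (frame⁻¹).val * conjAdjugate X * frame.val := by
        rw [h1]; simp only [mul_assoc, h2, mul_one]

/-! ### Coordinates and the isomorphism of Lie algebras -/

theorem mem_sl2R_iff {X : Matrix (Fin 2) (Fin 2) ℝ} : X ∈ sl2R ↔ X.trace = 0 :=
  Iff.rfl

theorem mem_soStar_iff {X : Matrix (Fin 2) (Fin 2) ℍ[ℝ]} :
    X ∈ soStar 2 ↔ X.trace.re = 0 ∧ -revTranspose X = X := Iff.rfl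

theorem suMatrix_mem (a b c : ℝ) : suMatrix a b c ∈ su 2 := by
  refine mem_su_iff.2 ⟨by simp [suMatrix, Matrix.trace_fin_two], ?_⟩
  ext i j
  fin_cases i <;> fin_cases j <;>
    simp [suMatrix, Matrix.conjTranspose_apply, Complex.ext_iff]

theorem slMatrix_mem (a b c : ℝ) : slMatrix a b c ∈ sl2R := by
  rw [mem_sl2R_iff]
  simp [slMatrix, Matrix.trace_fin_two]

theorem soStarMatrix_mem (a b c d e f : ℝ) : soStarMatrix a b c d e f ∈ soStar 2 := by
  refine mem_soStar_iff.2 ⟨by simp [soStarMatrix, Matrix.trace_fin_two], ?_⟩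
  ext1 i j
  fin_cases i <;> fin_cases j <;> ext <;> simp [soStarMatrix, revTranspose]

/-- Coordinates on `su(2) ⊕ sl(2, ℝ)`. -/
def suSlCoords : (su 2 × sl2R) ≃ₗ[ℝ] (Fin 6 → ℝ) where
  toFun X := ![2 * (X.1.val 1 0).im, 2 * (X.1.val 1 0).re, 2 * (X.1.val 0 0).im,
    -(X.2.val 0 1 + X.2.val 1 0), X.2.val 1 0 - X.2.val 0 1, 2 * X.2.val 1 1]
  map_add' X Y := by
    ext i
    fin_cases i <;> simp <;> ring
  map_smul' c X := by
    ext i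
    fin_cases i <;> simp <;> ring
  invFun θ := (⟨suMatrix (θ 0) (θ 1) (θ 2), suMatrix_mem _ _ _⟩,
    ⟨slMatrix (θ 3) (θ 4) (θ 5), slMatrix_mem _ _ _⟩)
  left_inv X := by
    refine Prod.ext (Subtype.ext ?_) (Subtype.ext ?_)
    · conv_rhs => rw [← quatToComplex_complexToQuat_su X.1]
      have h : (X.1.val 0 0).re = 0 := complexToQuat_su_re X.1
      ext i j
      fin_cases i <;> fin_cases j <;>
        simp [suMatrix, quatToComplex, complexToQuat_apply, Complex.ext_iff, h]
    · have h := mem_sl2R_iff.1 X.2.2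
      rw [Matrix.trace_fin_two] at h
      ext i j
      fin_cases i <;> fin_cases j <;> simp [slMatrix] <;> linarith
  right_inv θ := by
    ext i
    fin_cases i <;> simp [suMatrix, slMatrix] <;> ring

/-- Coordinates on `so*(4)`. -/
def soStarCoords : soStar 2 ≃ₗ[ℝ] (Fin 6 → ℝ) where
  toFun X := ![2 * (X.val 0 1).re, (X.val 0 0).imJ - (X.val 1 1).imJ, -2 * (X.val 0 1).imJ,
    2 * (X.val 0 1).imI, (X.val 0 0).imJ + (X.val 1 1).imJ, 2 * (X.val 0 1).imK]
  map_add' X Y := by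
    ext i
    fin_cases i <;> simp <;> ring
  map_smul' c X := by
    ext i
    fin_cases i <;> simp <;> ring
  invFun θ := ⟨soStarMatrix (θ 0) (θ 1) (θ 2) (θ 3) (θ 4) (θ 5), soStarMatrix_mem _ _ _ _ _ _⟩
  left_inv X := by
    apply Subtype.ext
    have h := fun i j => congrFun (congrFun (mem_soStar_iff.1 X.2).2 i) j
    have hr := fun i j => congrArg QuaternionAlgebra.re (h i j)
    have hi := fun i j => congrArg QuaternionAlgebra.imI (h i j)
    have hj := fun i j => congrArg QuaternionAlgebra.imJ (h i j)
    have hk := fun i j => congrArg QuaternionAlgebra.imK (h i j)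
    simp only [revTranspose, Matrix.neg_apply, Matrix.transpose_apply, Matrix.map_apply,
      Quaternion.re_neg, Quaternion.imI_neg, Quaternion.imJ_neg, Quaternion.imK_neg,
      reversion_re, reversion_imI, reversion_imJ, reversion_imK] at hr hi hj hk
    -- Diagonal entries reduce to their `j` part; the two off-diagonal entries share the `j` part
    -- and are opposite in the other three.
    have := hr 0 0; have := hr 0 1; have := hr 1 1
    have := hi 0 0; have := hi 0 1; have := hi 1 1
    have := hj 0 1
    have := hk 0 0; have := hk 0 1; have := hk 1 1
    ext1 i j
    fin_cases i <;> fin_cases j <;> ext <;> simp [soStarMatrix] <;> linarith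
  right_inv θ := by
    ext i
    fin_cases i <;> simp [soStarMatrix] <;> ring

theorem soStarMatrix_eq_frame_conj (θ : Fin 6 → ℝ) :
    soStarMatrix (θ 0) (θ 1) (θ 2) (θ 3) (θ 4) (θ 5) = (frame⁻¹).val *
      (scalarQuat (complexToQuat (suMatrix (θ 0) (θ 1) (θ 2))) +
        realToQuat (slMatrix (θ 3) (θ 4) (θ 5))) * frame.val := by
  have h : scalarQuat (complexToQuat (suMatrix (θ 0) (θ 1) (θ 2))) +
        realToQuat (slMatrix (θ 3) (θ 4) (θ 5)) =
      (1 / 2 : ℝ) • !![quat (-θ 5) (θ 0) (θ 1) (θ 2), quat (-θ 3 - θ 4) 0 0 0;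
        quat (θ 4 - θ 3) 0 0 0, quat (θ 5) (θ 0) (θ 1) (θ 2)] := by
    rw [slMatrix, map_smul]
    ext1 i j
    fin_cases i <;> fin_cases j <;> ext <;>
      simp [suMatrix, complexToQuat_apply, realToQuat_apply, Matrix.scalar_apply]
  have h2 : frame.val * soStarMatrix (θ 0) (θ 1) (θ 2) (θ 3) (θ 4) (θ 5) =
      (1 / 2 : ℝ) • !![quat (-θ 5) (θ 0) (θ 1) (θ 2), quat (-θ 3 - θ 4) 0 0 0;
        quat (θ 4 - θ 3) 0 0 0, quat (θ 5) (θ 0) (θ 1) (θ 2)] * frame.val := by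
    ext1 i j
    fin_cases i <;> fin_cases j <;> ext <;>
      simp [soStarMatrix, frame_val, Matrix.mul_apply, Fin.sum_univ_two] <;> ring
  rw [h, mul_assoc, ← h2, Units.inv_mul_cancel_left]

/-- The linear isomorphism `su(2) ⊕ sl(2, ℝ) ≃ so*(4)` matching the coordinates. -/
def suSlEquiv : (su 2 × sl2R) ≃ₗ[ℝ] soStar 2 := suSlCoords.trans soStarCoords.symm

/-- This coordinate-free form makes the bracket computation possible: `q` and `M` commute, so the
mixed terms of `[q + M, q' + M']` cancel. -/
theorem suSlEquiv_val (X : su 2 × sl2R) :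
    (suSlEquiv X).val = (frame⁻¹).val *
      (scalarQuat (complexToQuat X.1.val) + realToQuat X.2.val) * frame.val := by
  obtain ⟨θ, rfl⟩ := suSlCoords.symm.surjective X
  have : suSlEquiv (suSlCoords.symm θ) = soStarCoords.symm θ := by simp [suSlEquiv]
  rw [this]
  exact soStarMatrix_eq_frame_conj θ

/-- The isomorphism `su(2) ⊕ sl(2, ℝ) ≃ so*(4)` of Lie algebras. -/
def suSlLieEquiv : (su 2 × sl2R) ≃ₗ⁅ℝ⁆ soStar 2 :=
  { suSlEquiv with
    map_lie' := by
      intro X Y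
      apply Subtype.ext
      have h : ∀ A B : soStar 2, ⁅A, B⁆.val = A.val * B.val - B.val * A.val := fun _ _ => rfl
      have h' : ⁅X, Y⁆.2.val = X.2.val * Y.2.val - Y.2.val * X.2.val := rfl
      have h'' : complexToQuat ⁅X, Y⁆.1.val = _ := complexToQuat_lie_su X.1 Y.1
      have c1 := (scalarQuat_commute_realToQuat (complexToQuat X.1.val) Y.2.val).eq
      have c2 := (scalarQuat_commute_realToQuat (complexToQuat Y.1.val) X.2.val).eq
      change (suSlEquiv ⁅X, Y⁆).val = ⁅suSlEquiv X, suSlEquiv Y⁆.val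
      rw [h, suSlEquiv_val, suSlEquiv_val, suSlEquiv_val, h', h'']
      simp only [map_sub, map_mul, mul_assoc, Units.mul_inv_cancel_left]
      simp only [← mul_assoc, ← sub_mul]
      congr 1
      simp only [mul_assoc, ← mul_sub]
      congr 1
      simp only [mul_add, add_mul, c1, c2]
      abel }

theorem suSlLieEquiv_apply (X : su 2 × sl2R) : suSlLieEquiv X = suSlEquiv X := rfl

/-! ### The group homomorphism and its kernel -/

theorem conjAdjugate_scalarQuat_mul_realToQuat (q : ℍ[ℝ]) (M : Matrix (Fin 2) (Fin 2) ℝ) :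
    conjAdjugate (scalarQuat q * realToQuat M) = scalarQuat (star q) * realToQuat M.adjugate := by
  ext1 i j
  rw [scalarQuat_mul_realToQuat_apply]
  fin_cases i <;> fin_cases j <;>
    simp [conjAdjugate, -Matrix.scalar_apply, scalarQuat_mul_realToQuat_apply,
      Matrix.adjugate_fin_two, Quaternion.coe_commutes]

theorem scalarQuat_mul_realToQuat_mul (p q : ℍ[ℝ]) (M N : Matrix (Fin 2) (Fin 2) ℝ) :
    scalarQuat p * realToQuat M * (scalarQuat q * realToQuat N) =
      scalarQuat (p * q) * realToQuat (M * N) := by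
  rw [map_mul, map_mul, mul_assoc, ← mul_assoc (realToQuat M),
    ← (scalarQuat_commute_realToQuat q M).eq]
  simp only [mul_assoc]

/-- The map `(g, h) ↦ P⁻¹ (q h) P`, with `q` the quaternion of `g`, into matrices. -/
def coverMatrix : (SU2 × SL2R) →* Matrix (Fin 2) (Fin 2) ℍ[ℝ] where
  toFun x := (frame⁻¹).val * (scalarQuat (complexToQuat x.1.val) * realToQuat x.2.val) * frame.val
  map_one' := by
    have h1 : complexToQuat (1 : SU2 × SL2R).1.val = 1 := complexToQuat_one
    have h2 : (1 : SU2 × SL2R).2.val = 1 := rfl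
    rw [h1, h2]
    simp
  map_mul' x y := by
    have h1 : complexToQuat (x * y).1.val = complexToQuat x.1.val * complexToQuat y.1.val :=
      complexToQuat_mul_SU2 x.1 y.1
    have h2 : (x * y).2.val = x.2.val * y.2.val := rfl
    rw [h1, h2, ← scalarQuat_mul_realToQuat_mul]
    simp only [mul_assoc, Units.mul_inv_cancel_left]

theorem coverMatrix_apply (x : SU2 × SL2R) : coverMatrix x =
    (frame⁻¹).val * (scalarQuat (complexToQuat x.1.val) * realToQuat x.2.val) * frame.val := rfl

theorem studyDet_coverMatrix (x : SU2 × SL2R) : studyDet 2 (coverMatrix x) = 1 := by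
  -- Study determinants lie in the commutative `ℂ`, so the contributions of the frame and its
  -- inverse cancel.
  rw [coverMatrix_apply, map_mul, map_mul, mul_comm, ← mul_assoc, ← map_mul, Units.mul_inv,
    map_one, one_mul, map_mul, studyDet_scalarQuat, studyDet_realToQuat,
    normSq_complexToQuat_SU2, x.2.det_coe]
  simp

theorem revTranspose_coverMatrix_mul (x : SU2 × SL2R) :
    revTranspose (coverMatrix x) * coverMatrix x = 1 := by
  rw [coverMatrix_apply, revTranspose_frame_conj, conjAdjugate_scalarQuat_mul_realToQuat]
  simp only [mul_assoc, Units.mul_inv_cancel_left]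
  have h : scalarQuat (star (complexToQuat x.1.val)) * (realToQuat x.2.val.adjugate *
      (scalarQuat (complexToQuat x.1.val) * (realToQuat x.2.val * frame.val))) = frame.val := by
    simp only [← mul_assoc]
    rw [mul_assoc _ (scalarQuat (complexToQuat x.1.val)), scalarQuat_mul_realToQuat_mul,
      Quaternion.star_mul_self, normSq_complexToQuat_SU2, Matrix.adjugate_mul, x.2.det_coe]
    simp
  rw [h, Units.inv_mul]

/-- The double covering `SU(2) × SL(2, ℝ) → SO*(4)`. -/
def cover : (SU2 × SL2R) →* SOStar 2 where
  toFun x := ⟨coverMatrix.toHomUnits x, studyDet_coverMatrix x, revTranspose_coverMatrix_mul x⟩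
  map_one' := Subtype.ext (map_one _)
  map_mul' x y := Subtype.ext (map_mul _ x y)

theorem cover_val (x : SU2 × SL2R) : (cover x).val.val = coverMatrix x := rfl

theorem cover_eq_iff {x : SU2 × SL2R} {O : SOStar 2} :
    cover x = O ↔ scalarQuat (complexToQuat x.1.val) * realToQuat x.2.val =
      frame.val * O.val.val * (frame⁻¹).val := by
  rw [Subtype.ext_iff, Units.ext_iff, cover_val, coverMatrix_apply, Units.eq_mul_inv_iff_mul_eq,
    mul_assoc, Units.inv_mul_eq_iff_eq_mul]

theorem normSq_eq_one_cases {q : ℍ[ℝ]} {r : ℝ} (hq : Quaternion.normSq q = 1) (h : q * r = 1) :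
    (q = 1 ∧ r = 1) ∨ (q = -1 ∧ r = -1) := by
  have hr : r * r = 1 := by
    have := congrArg Quaternion.normSq h
    rw [map_mul, hq, Quaternion.normSq_coe] at this
    simpa [sq] using this
  rcases mul_self_eq_one_iff.1 hr with rfl | rfl
  · exact Or.inl ⟨by simpa using h, rfl⟩
  · refine Or.inr ⟨?_, rfl⟩
    rw [Quaternion.coe_neg, Quaternion.coe_one, mul_neg, mul_one] at h
    rw [← h, neg_neg]

/-- In `q M = 1` the off-diagonal entries of `M` vanish because `q ≠ 0`, and each diagonal entry
equals `q = ±1`. The same `q` occurs in both, which excludes mixed signs. -/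
theorem cover_ker : cover.ker = diagSign := by
  ext x
  have hd : x ∈ diagSign ↔ (x.1.val = 1 ∧ x.2.val = 1) ∨ (x.1.val = -1 ∧ x.2.val = -1) := Iff.rfl
  rw [MonoidHom.mem_ker, hd, cover_eq_iff]
  have h1 : frame.val * (1 : SOStar 2).val.val * (frame⁻¹).val = 1 := by simp
  rw [h1]
  constructor
  · intro h
    have e := fun i j => congrFun (congrFun h i) j
    simp only [scalarQuat_mul_realToQuat_apply] at e
    have hn := normSq_complexToQuat_SU2 x.1
    have hq : complexToQuat x.1.val ≠ 0 := by
      intro h0; simp [h0] at hn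
    have e01 : x.2.val 0 1 = 0 :=
      Quaternion.coe_injective ((mul_eq_zero.1 (e 0 1)).resolve_left hq)
    have e10 : x.2.val 1 0 = 0 :=
      Quaternion.coe_injective ((mul_eq_zero.1 (e 1 0)).resolve_left hq)
    rw [← quatToComplex_complexToQuat_SU2 x.1]
    rcases normSq_eq_one_cases hn (e 0 0) with ⟨a, b⟩ | ⟨a, b⟩ <;>
      rcases normSq_eq_one_cases hn (e 1 1) with ⟨c, d⟩ | ⟨c, d⟩
    · refine Or.inl ⟨by simp [a], ?_⟩
      ext i j
      fin_cases i <;> fin_cases j <;> simp [b, d, e01, e10]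
    · exfalso
      have := congrArg QuaternionAlgebra.re (a.symm.trans c)
      norm_num at this
    · exfalso
      have := congrArg QuaternionAlgebra.re (a.symm.trans c)
      norm_num at this
    · refine Or.inr ⟨by simp [a], ?_⟩
      ext i j
      fin_cases i <;> fin_cases j <;> simp [b, d, e01, e10]
  · rintro (⟨a, b⟩ | ⟨a, b⟩) <;> simp [a, b, complexToQuat_one]

theorem cover_eq_neg_one {g : SU2} {h : SL2R}
    (H : (g.val = -1 ∧ h.val = 1) ∨ (g.val = 1 ∧ h.val = -1)) : (cover (g, h)).val.val = -1 := by
  rw [cover_val, coverMatrix_apply]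
  rcases H with ⟨a, b⟩ | ⟨a, b⟩ <;> simp [a, b, complexToQuat_one, -Matrix.scalar_apply]

/-- The diagonal sign change in `SU(2) × SL(2, ℝ)`. -/
def negOne : SU2 × SL2R :=
  (⟨-1, by simp [Matrix.mem_specialUnitaryGroup_iff, Matrix.mem_unitaryGroup_iff, Matrix.det_neg]⟩,
    ⟨-1, by simp [Matrix.det_neg]⟩)

theorem negOne_ne_one : negOne ≠ 1 := by
  intro h
  have h2 : (-1 : Matrix (Fin 2) (Fin 2) ℝ) = 1 := congrArg (fun x => x.2.val) h
  have := congrFun (congrFun h2 0) 0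
  norm_num at this

theorem coe_diagSign : (diagSign : Set (SU2 × SL2R)) = {1, negOne} := by
  ext x
  have key : ∀ y : SU2 × SL2R, x = y ↔ x.1.val = y.1.val ∧ x.2.val = y.2.val := fun y => by
    rw [Prod.ext_iff]
    exact and_congr Subtype.ext_iff Subtype.ext_iff
  rw [Set.mem_insert_iff, Set.mem_singleton_iff, key, key]
  exact Iff.rfl

/-- The fibre through `x` is the coset of the kernel by `x`. -/
theorem preimage_singleton_ncard {G H : Type*} [Group G] [Group H] (f : G →* H)
    (hf : Function.Surjective f) (y : H) : (f ⁻¹' {y}).ncard = (f.ker : Set G).ncard := by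
  obtain ⟨x, rfl⟩ := hf y
  have : f ⁻¹' {f x} = (fun z => x * z) '' (f.ker : Set G) := by
    ext z
    simp only [Set.mem_preimage, Set.mem_singleton_iff, Set.mem_image, SetLike.mem_coe,
      MonoidHom.mem_ker]
    refine ⟨fun h => ⟨x⁻¹ * z, by simp [h], by simp⟩, ?_⟩
    rintro ⟨w, hw, rfl⟩
    simp [hw]
  rw [this, Set.ncard_image_of_injective _ (mul_right_injective x)]

/-! ### Surjectivity: the entries are proportional over `ℝ` -/

/-- The relation `p̄ r = r̄ p` says that `p̄ r` is real, that is, `p` and `r` are linearly dependent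
over `ℝ`. It passes through a nonzero `m` because `|m|² p̄ r = (p̄ m)(m̄ r)` is a product of two
reals. -/
theorem star_mul_comm_trans {p m r : ℍ[ℝ]} (hm : m ≠ 0) (h₁ : star p * m = star m * p)
    (h₂ : star m * r = star r * m) : star p * r = star r * p := by
  have e₁ : star p * m = ((star p * m).re : ℍ[ℝ]) :=
    Quaternion.star_eq_self.1 (by rw [star_mul, star_star, h₁])
  have e₂ : star m * r = ((star m * r).re : ℍ[ℝ]) :=
    Quaternion.star_eq_self.1 (by rw [star_mul, star_star, h₂])
  have hn : ((Quaternion.normSq m : ℝ) : ℍ[ℝ]) ≠ 0 := by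
    rw [← Quaternion.self_mul_star]
    exact mul_ne_zero hm (star_ne_zero.2 hm)
  apply mul_left_cancel₀ hn
  have key : ∀ a b : ℍ[ℝ], ((Quaternion.normSq m : ℝ) : ℍ[ℝ]) * (a * b) = (a * m) * (star m * b) :=
    fun a b => by
      rw [← mul_assoc, Quaternion.coe_commutes (Quaternion.normSq m) a,
        ← Quaternion.self_mul_star]
      simp only [mul_assoc]
  rw [key, key, ← h₁, ← h₂, e₁, e₂, Quaternion.coe_commutes (star p * m).re]

theorem star_mul_comm_of_mul_star_comm {p r : ℍ[ℝ]} (h : p * star r = r * star p) :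
    star p * r = star r * p := by
  rcases eq_or_ne p 0 with rfl | hp
  · simp
  apply mul_right_cancel₀ (star_ne_zero.2 hp)
  rw [mul_assoc, ← h, ← mul_assoc, mul_assoc (star r), Quaternion.self_mul_star,
    Quaternion.star_mul_self, Quaternion.coe_commutes (Quaternion.normSq p)]

/-- The entries of a matrix preserving the skew-Hermitian form are real multiples of a single
quaternion. -/
theorem star_entry_mul_comm {X : Matrix (Fin 2) (Fin 2) ℍ[ℝ]} (h : conjAdjugate X * X = 1)
    (i j k l : Fin 2) : star (X i j) * X k l = star (X k l) * X i j := by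
  -- The left inverse relates entries within a column, the right inverse entries within a row.
  have h' : X * conjAdjugate X = 1 := mul_eq_one_comm.1 h
  have e := fun i j => congrFun (congrFun h i) j
  have e' := fun i j => congrFun (congrFun h' i) j
  have e00 := e 0 0
  have e01 := e 0 1
  have e10 := e 1 0
  have e11 := e 1 1
  have r01 := e' 0 1
  have r10 := e' 1 0
  simp [Matrix.mul_apply, Fin.sum_univ_two, conjAdjugate] at e00 e01 e10 e11 r01 r10
  have c0 : star (X 0 0) * X 1 0 = star (X 1 0) * X 0 0 := by
    rwa [neg_add_eq_zero, eq_comm] at e10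
  have c1 : star (X 0 1) * X 1 1 = star (X 1 1) * X 0 1 := by
    rw [add_neg_eq_zero] at e01; exact e01.symm
  have r0 : star (X 0 0) * X 0 1 = star (X 0 1) * X 0 0 :=
    star_mul_comm_of_mul_star_comm (by rwa [neg_add_eq_zero] at r01)
  have r1 : star (X 1 0) * X 1 1 = star (X 1 1) * X 1 0 :=
    star_mul_comm_of_mul_star_comm (by rwa [add_neg_eq_zero] at r10)
  -- Opposite corners are compared through a third entry; if that entry is zero, the diagonal
  -- equations alone make both sides equal to `1`, or to `-1` for the other pair of corners.
  have d : star (X 0 0) * X 1 1 = star (X 1 1) * X 0 0 := by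
    by_cases hb : X 0 1 = 0
    · rw [hb] at e00 e11
      simp at e00 e11
      rw [e00, e11]
    · exact star_mul_comm_trans hb r0 c1
  have a : star (X 0 1) * X 1 0 = star (X 1 0) * X 0 1 := by
    by_cases hb : X 0 0 = 0
    · rw [hb] at e00 e11
      simp at e00 e11
      rw [← neg_inj, e00, e11]
    · exact star_mul_comm_trans hb r0.symm c0
  fin_cases i <;> fin_cases j <;> fin_cases k <;> fin_cases l <;>
    first
      | rfl
      | assumption
      | (symm; assumption)

/-- The unit quaternion in the direction of the entry `(i, j)`. -/
def unitEntry (i j : Fin 2) (X : Matrix (Fin 2) (Fin 2) ℍ[ℝ]) : ℍ[ℝ] := ‖X i j‖⁻¹ • X i j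

/-- The real matrix left after dividing by the direction of the entry `(i, j)`. -/
def realPart (i j : Fin 2) (X : Matrix (Fin 2) (Fin 2) ℍ[ℝ]) : Matrix (Fin 2) (Fin 2) ℝ :=
  Matrix.of fun k l => (star (unitEntry i j X) * X k l).re

theorem normSq_unitEntry {i j : Fin 2} {X : Matrix (Fin 2) (Fin 2) ℍ[ℝ]} (h : X i j ≠ 0) :
    Quaternion.normSq (unitEntry i j X) = 1 := by
  have := norm_ne_zero_iff.2 h
  rw [unitEntry, Quaternion.normSq_smul, Quaternion.normSq_eq_norm_mul_self]
  field_simp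

theorem scalarQuat_unitEntry_mul_realPart {i j : Fin 2} {X : Matrix (Fin 2) (Fin 2) ℍ[ℝ]}
    (h : conjAdjugate X * X = 1) (hij : X i j ≠ 0) :
    scalarQuat (unitEntry i j X) * realToQuat (realPart i j X) = X := by
  ext1 k l
  have e : star (star (unitEntry i j X) * X k l) = star (unitEntry i j X) * X k l := by
    simp only [unitEntry, star_mul, star_star, Quaternion.star_smul, smul_mul_assoc,
      star_entry_mul_comm h i j k l]
  rw [scalarQuat_mul_realToQuat_apply, realPart, Matrix.of_apply, ← Quaternion.star_eq_self.1 e,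
    ← mul_assoc, Quaternion.self_mul_star, normSq_unitEntry hij, Quaternion.coe_one, one_mul]

/-- For `X = q M` with `|q| = 1` the equation reads `q̄ q adj M M = 1`, and its left side is `det
M`. -/
theorem det_realPart {i j : Fin 2} {X : Matrix (Fin 2) (Fin 2) ℍ[ℝ]}
    (h : conjAdjugate X * X = 1) (hij : X i j ≠ 0) : (realPart i j X).det = 1 := by
  rw [← scalarQuat_unitEntry_mul_realPart h hij, conjAdjugate_scalarQuat_mul_realToQuat,
    scalarQuat_mul_realToQuat_mul, Quaternion.star_mul_self, normSq_unitEntry hij,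
    Matrix.adjugate_mul] at h
  have := congrFun (congrFun h 0) 0
  rw [scalarQuat_mul_realToQuat_apply] at this
  apply Quaternion.coe_injective
  simpa using this

/-- The matrix of an element of `SO*(4)` after the change of basis. -/
def inFrame (O : SOStar 2) : Matrix (Fin 2) (Fin 2) ℍ[ℝ] := frame.val * O.val.val * (frame⁻¹).val

theorem conjAdjugate_inFrame_mul (O : SOStar 2) : conjAdjugate (inFrame O) * inFrame O = 1 := by
  have hO : (frame⁻¹).val * inFrame O * frame.val = O.val.val := by simp [inFrame, mul_assoc]
  have h := revTranspose_frame_conj (inFrame O)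
  rw [hO] at h
  have h2 : conjAdjugate (inFrame O) = frame.val * revTranspose O.val.val * (frame⁻¹).val := by
    simp [h, mul_assoc]
  have h3 : revTranspose O.val.val * O.val.val = 1 := O.2.2
  rw [h2, inFrame]
  calc _ = frame.val * (revTranspose O.val.val * O.val.val) * (frame⁻¹).val := by
        simp only [mul_assoc, Units.inv_mul_cancel_left]
    _ = 1 := by rw [h3, mul_one, Units.mul_inv]

/-- A preimage under `cover`, read off from a nonzero entry. -/
def coverSection (i j : Fin 2) (O : SOStar 2) (h : inFrame O i j ≠ 0) : SU2 × SL2R :=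
  (⟨quatToComplex (unitEntry i j (inFrame O)), quatToComplex_mem_SU2 (normSq_unitEntry h)⟩,
    ⟨realPart i j (inFrame O), det_realPart (conjAdjugate_inFrame_mul O) h⟩)

theorem cover_coverSection (i j : Fin 2) (O : SOStar 2) (h : inFrame O i j ≠ 0) :
    cover (coverSection i j O h) = O := by
  rw [cover_eq_iff]
  simp only [coverSection, complexToQuat_quatToComplex]
  exact scalarQuat_unitEntry_mul_realPart (conjAdjugate_inFrame_mul O) h

theorem cover_surjective : Function.Surjective cover := by
  intro O
  obtain ⟨i, j, h⟩ : ∃ i j, inFrame O i j ≠ 0 := by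
    by_contra! h
    have h0 : inFrame O = 0 := by ext1 i j; exact h i j
    have := conjAdjugate_inFrame_mul O
    rw [h0, mul_zero] at this
    exact zero_ne_one this
  exact ⟨_, cover_coverSection i j O h⟩

/-! ### Continuity, openness and the covering property -/

instance : IsTopologicalGroup SU2 where
  continuous_inv := continuous_star.comp continuous_subtype_val |>.subtype_mk _

theorem continuous_realToQuat : Continuous realToQuat :=
  LinearMap.continuous_of_finiteDimensional realToQuat.toLinearMap

theorem continuous_scalarQuat : Continuous scalarQuat := by
  refine continuous_matrix fun i j => ?_
  simp only [Matrix.scalar_apply, Matrix.diagonal_apply]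
  split_ifs <;> fun_prop

theorem continuous_complexToQuat : Continuous complexToQuat :=
  LinearMap.continuous_of_finiteDimensional _

theorem continuous_quatToComplex : Continuous quatToComplex := by
  have : Continuous fun q : ℍ[ℝ] => (quatToComplex q) := by
    refine continuous_matrix fun i j => ?_
    have h1 := Quaternion.continuous_re
    have h2 := Quaternion.continuous_imI
    have h3 := Quaternion.continuous_imJ
    have h4 := Quaternion.continuous_imK
    fin_cases i <;> fin_cases j <;> simp [quatToComplex] <;> fun_prop
  exact this

theorem continuous_SL2R_val : Continuous fun h : SL2R => h.val := continuous_subtype_val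

theorem continuous_coverMatrix : Continuous coverMatrix := by
  have h : Continuous fun x : SU2 × SL2R => (frame⁻¹).val *
      (scalarQuat (complexToQuat x.1.val) * realToQuat x.2.val) * frame.val := by
    refine (continuous_const.mul (Continuous.mul ?_ ?_)).mul continuous_const
    · exact continuous_scalarQuat.comp (continuous_complexToQuat.comp
        (continuous_subtype_val.comp continuous_fst))
    · exact continuous_realToQuat.comp (continuous_SL2R_val.comp continuous_snd)
  exact h

theorem continuous_cover : Continuous cover := by
  have hu : Continuous coverMatrix.toHomUnits := by
    refine Units.continuous_iff.2 ⟨continuous_coverMatrix, ?_⟩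
    have h : (fun x : SU2 × SL2R => ((coverMatrix.toHomUnits x)⁻¹).val) =
        fun x => coverMatrix x⁻¹ := by
      ext1 x
      rw [← map_inv]
      rfl
    rw [h]
    exact continuous_coverMatrix.comp continuous_inv
  exact hu.subtype_mk _

open Topology in
theorem isOpenMap_cover : IsOpenMap cover := by
  refine IsTopologicalGroup.isOpenMap_iff_nhds_one.2 fun U hU => ?_
  rw [Filter.mem_map] at hU
  -- Both factors carry the topology of their ambient matrix spaces, so it suffices that the section
  -- through the entry `(0, 0)` is continuous at `1` as a pair of matrices.
  have hind : IsInducing fun x : SU2 × SL2R => (x.1.val, x.2.val) :=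
    IsInducing.prodMap (f := fun g : SU2 => g.val) (g := fun h : SL2R => h.val) .subtypeVal
      Matrix.SpecialLinearGroup.isClosedEmbedding_val.isInducing
  obtain ⟨V, hV, hVU⟩ := (hind.nhds_eq_comap 1 ▸ hU : _ ∈ Filter.comap _ _)
  have hfr : Continuous inFrame :=
    (continuous_const.mul (Units.continuous_val.comp continuous_subtype_val)).mul continuous_const
  have h1 : inFrame 1 = 1 := by simp [inFrame]
  have hne : inFrame 1 0 0 ≠ 0 := by simp [h1]
  have hent : ∀ k l, Continuous fun O => inFrame O k l := fun k l => hfr.matrix_elem k l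
  have hu : ContinuousAt (fun O => unitEntry 0 0 (inFrame O)) 1 :=
    ((hent 0 0).norm.continuousAt.inv₀ (norm_ne_zero_iff.2 hne)).smul (hent 0 0).continuousAt
  have hr : ContinuousAt (fun O => realPart 0 0 (inFrame O)) 1 := by
    refine continuousAt_pi.2 fun k => continuousAt_pi.2 fun l => ?_
    exact Quaternion.continuous_re.continuousAt.comp
      ((continuous_star.continuousAt.comp hu).mul (hent k l).continuousAt)
  have hs : ContinuousAt (fun O => (quatToComplex (unitEntry 0 0 (inFrame O)),
      realPart 0 0 (inFrame O))) 1 :=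
    (continuous_quatToComplex.continuousAt.comp hu).prodMk hr
  have hs1 : (quatToComplex (unitEntry 0 0 (inFrame 1)), realPart 0 0 (inFrame 1)) =
      ((1 : SU2 × SL2R).1.val, (1 : SU2 × SL2R).2.val) := by
    have hq : unitEntry 0 0 (1 : Matrix (Fin 2) (Fin 2) ℍ[ℝ]) = 1 := by simp [unitEntry]
    have hM : realPart 0 0 (1 : Matrix (Fin 2) (Fin 2) ℍ[ℝ]) = 1 := by
      ext i j
      fin_cases i <;> fin_cases j <;> simp [realPart, hq]
    rw [h1, hq, hM, map_one]
    rfl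
  rw [← hs1] at hV
  filter_upwards [hs.preimage_mem_nhds hV, (hent 0 0).continuousAt.eventually_ne hne] with O hO hO0
  exact cover_coverSection 0 0 O hO0 ▸ hVU (a := coverSection 0 0 O hO0) hO

theorem cover_isOpenQuotientMap : IsOpenQuotientMap cover :=
  ⟨cover_surjective, continuous_cover, isOpenMap_cover⟩

theorem isDiscrete_ker_cover : IsDiscrete (cover.ker : Set (SU2 × SL2R)) := by
  rw [cover_ker, coe_diagSign]
  exact (Set.toFinite _).isDiscrete

theorem isCoveringMap_cover : IsCoveringMap cover :=
  (Topology.IsQuotientMap.isQuotientCoveringMap_of_isDiscrete_ker_monoidHom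
    cover_isOpenQuotientMap.isQuotientMap isDiscrete_ker_cover).isCoveringMap

theorem cover_preimage_ncard (O : SOStar 2) : (cover ⁻¹' {O}).ncard = 2 := by
  rw [preimage_singleton_ncard _ cover_surjective, cover_ker, coe_diagSign,
    Set.ncard_pair negOne_ne_one.symm]

/-! ### Exponentials -/

open NormedSpace

theorem exp_frame_conj (X : Matrix (Fin 2) (Fin 2) ℍ[ℝ]) :
    exp ((frame⁻¹).val * X * frame.val) = (frame⁻¹).val * exp X * frame.val := by
  let +nondep : NormedAlgebra ℚ ℍ := .restrictScalars ℚ ℝ ℍ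
  exact Matrix.exp_units_conj' frame X

open scoped Matrix.Norms.Operator in
theorem scalarQuat_exp (q : ℍ[ℝ]) : scalarQuat (exp q) = exp (scalarQuat q) := by
  let +nondep : NormedAlgebra ℚ ℍ := .restrictScalars ℚ ℝ ℍ
  exact map_exp scalarQuat continuous_scalarQuat q

open scoped Matrix.Norms.Operator in
theorem quatToComplex_exp (q : ℍ[ℝ]) : quatToComplex (exp q) = exp (quatToComplex q) := by
  let +nondep : NormedAlgebra ℚ ℍ := .restrictScalars ℚ ℝ ℍ
  exact map_exp quatToComplex continuous_quatToComplex q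

open scoped Matrix.Norms.Operator in
theorem realToQuat_exp (M : Matrix (Fin 2) (Fin 2) ℝ) :
    realToQuat (exp M) = exp (realToQuat M) := by
  let +nondep : NormedAlgebra ℚ (Matrix (Fin 2) (Fin 2) ℝ) := .restrictScalars ℚ ℝ _
  exact map_exp realToQuat continuous_realToQuat M

theorem exp_su (X : su 2) : exp X.val = quatToComplex (exp (complexToQuat X.val)) := by
  rw [quatToComplex_exp, quatToComplex_complexToQuat_su]

theorem exp_su_mem (X : su 2) : exp X.val ∈ SU2 := by
  rw [exp_su]
  apply quatToComplex_mem_SU2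
  rw [Quaternion.normSq_exp, complexToQuat_su_re, exp_zero, one_pow]

theorem adjugate_fin_two_eq_conj (A : Matrix (Fin 2) (Fin 2) ℝ) :
    A.adjugate = !![0, 1; -1, 0] * Aᵀ * (!![0, 1; -1, 0])⁻¹ := by
  have h : (!![0, 1; -1, 0] : Matrix (Fin 2) (Fin 2) ℝ)⁻¹ = !![0, -1; 1, 0] := by
    apply Matrix.inv_eq_left_inv
    ext i j
    fin_cases i <;> fin_cases j <;> simp
  rw [h]
  ext i j
  fin_cases i <;> fin_cases j <;>
    simp [Matrix.adjugate_fin_two, Matrix.mul_apply, Matrix.vecMul, dotProduct, Fin.sum_univ_two]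

/-- For `2 × 2` matrices the adjugate is a conjugate of the transpose, and `exp` respects both
operations. -/
theorem adjugate_exp_fin_two (A : Matrix (Fin 2) (Fin 2) ℝ) :
    (exp A).adjugate = exp A.adjugate := by
  have hJ : IsUnit (!![0, 1; -1, 0] : Matrix (Fin 2) (Fin 2) ℝ) := by
    rw [Matrix.isUnit_iff_isUnit_det]
    simp
  rw [adjugate_fin_two_eq_conj, adjugate_fin_two_eq_conj, Matrix.exp_conj _ _ hJ,
    Matrix.exp_transpose]

/-- Trace zero means `adj Y = -Y`, so the adjugate of `exp Y` is its inverse, and `adj A * A = det A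
• 1` gives the determinant. -/
theorem det_exp_sl2R (Y : sl2R) : (exp Y.val).det = 1 := by
  have ht := mem_sl2R_iff.1 Y.2
  rw [Matrix.trace_fin_two] at ht
  have hadj : Y.val.adjugate = -Y.val := by
    rw [Matrix.adjugate_fin_two]
    ext i j
    fin_cases i <;> fin_cases j <;> simp <;> linarith
  have h := Matrix.adjugate_mul (exp Y.val)
  have hu : IsUnit (exp Y.val) := Matrix.isUnit_exp Y.val
  rw [Matrix.isUnit_iff_isUnit_det] at hu
  rw [adjugate_exp_fin_two, hadj, Matrix.exp_neg,
    Matrix.nonsing_inv_mul _ hu] at h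
  have := congrFun (congrFun h 0) 0
  simpa using this.symm

theorem exp_suSlLieEquiv (X : su 2) (Y : sl2R) : exp (suSlLieEquiv (X, Y)).val =
    (frame⁻¹).val * (scalarQuat (exp (complexToQuat X.val)) * realToQuat (exp Y.val)) *
      frame.val := by
  let +nondep : NormedAlgebra ℚ ℍ := .restrictScalars ℚ ℝ ℍ
  have h := scalarQuat_commute_realToQuat (complexToQuat X.val) Y.val
  rw [suSlLieEquiv_apply, suSlEquiv_val, exp_frame_conj, scalarQuat_exp, realToQuat_exp]
  congr 2
  exact Matrix.exp_add_of_commute _ _ h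

theorem cover_eq_exp {X : su 2} {Y : sl2R} {g : SU2} {h : SL2R} (hg : g.val = exp X.val)
    (hh : h.val = exp Y.val) : (cover (g, h)).val.val = exp (suSlLieEquiv (X, Y)).val := by
  rw [exp_suSlLieEquiv, cover_val, coverMatrix_apply, hg, hh, exp_su,
    complexToQuat_quatToComplex]

theorem exists_cover_eq_exp (X : su 2) (Y : sl2R) : ∃ (g : SU2) (h : SL2R),
    g.val = exp X.val ∧ h.val = exp Y.val ∧
      (cover (g, h)).val.val = exp (suSlLieEquiv (X, Y)).val :=
  ⟨⟨exp X.val, exp_su_mem X⟩, ⟨exp Y.val, det_exp_sl2R Y⟩, rfl, rfl, cover_eq_exp rfl rfl⟩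

/-! ### The quotient isomorphism and the bases -/

/-- The isomorphism of topological groups induced by `cover`. -/
def quotientCoverEquiv : ((SU2 × SL2R) ⧸ diagSign) ≃ₜ* SOStar 2 :=
  let f : ((SU2 × SL2R) ⧸ diagSign) →* SOStar 2 := QuotientGroup.lift diagSign cover
    fun x hx => by rwa [← cover_ker] at hx
  have hinj : Function.Injective f := by
    rw [injective_iff_map_eq_one]
    intro x
    induction x using QuotientGroup.induction_on with
    | H x =>
      intro hx
      rw [QuotientGroup.eq_one_iff, ← cover_ker]
      exact hx
  have hsurj : Function.Surjective f := fun y =>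
    let ⟨x, hx⟩ := cover_surjective y
    ⟨QuotientGroup.mk x, hx⟩
  have hcont : Continuous f := continuous_quot_lift _ continuous_cover
  have hopen : IsOpenMap f := fun U hU => by
    have h : f '' U = cover '' (QuotientGroup.mk ⁻¹' U) := by
      ext y
      constructor
      · rintro ⟨x, hx, rfl⟩
        induction x using QuotientGroup.induction_on with
        | H x => exact ⟨x, hx, rfl⟩
      · rintro ⟨x, hx, rfl⟩
        exact ⟨QuotientGroup.mk x, hx, rfl⟩
    rw [h]
    exact isOpenMap_cover _ (hU.preimage QuotientGroup.continuous_mk)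
  .mk' ((Equiv.ofBijective f ⟨hinj, hsurj⟩).toHomeomorphOfContinuousOpen hcont hopen) (map_mul f)

theorem quotientCoverEquiv_mk (x : SU2 × SL2R) :
    quotientCoverEquiv (QuotientGroup.mk x) = cover x := rfl

theorem sum_smul_ofEquivFun {V : Type*} [AddCommGroup V] [Module ℝ V]
    (c : V ≃ₗ[ℝ] (Fin 6 → ℝ)) (θ : Fin 6 → ℝ) :
    ∑ i, θ i • Module.Basis.ofEquivFun c i = c.symm θ := by
  rw [← Module.Basis.equivFun_symm_apply, Module.Basis.equivFun_ofEquivFun]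

end QuatOrth

end

theorem mainTheorem2 :
    -- bases `S` and `A` of the two Lie algebras
    ∃ (S : Module.Basis (Fin 6) ℝ (su 2 × sl2R)) (A : Module.Basis (Fin 6) ℝ (soStar 2)),
      (∀ θ : Fin 6 → ℝ,
        (∑ i, θ i • S i).1.val = suMatrix (θ 0) (θ 1) (θ 2) ∧
        (∑ i, θ i • S i).2.val = slMatrix (θ 3) (θ 4) (θ 5) ∧
        (∑ i, θ i • A i).val = soStarMatrix (θ 0) (θ 1) (θ 2) (θ 3) (θ 4) (θ 5)) ∧
      -- the splitting `su(2) ⊕ sl(2, ℝ) ≅ so*(4)` of Lie algebras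
      ∃ σ : (su 2 × sl2R) ≃ₗ⁅ℝ⁆ soStar 2,
        (∀ i, σ (S i) = A i) ∧
        -- the double covering of groups, induced by `σ`
        ∃ Φ : (SU2 × SL2R) →* SOStar 2,
          (∀ (X : su 2) (Y : sl2R), ∃ (g : SU2) (h : SL2R),
            g.val = NormedSpace.exp X.val ∧ h.val = NormedSpace.exp Y.val ∧
            (Φ (g, h)).val.val = NormedSpace.exp (σ (X, Y)).val) ∧
          IsCoveringMap Φ ∧
          Function.Surjective Φ ∧
          (∀ O : SOStar 2, (Φ ⁻¹' {O}).ncard = 2) ∧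
          -- the kernel, and the images of the two remaining sign changes
          Φ.ker = diagSign ∧
          (∀ (g : SU2) (h : SL2R),
            (g.val = -1 ∧ h.val = 1) ∨ (g.val = 1 ∧ h.val = -1) →
              (Φ (g, h)).val.val = -1) ∧
          -- the resulting isomorphism of topological groups
          ∃ e : ((SU2 × SL2R) ⧸ diagSign) ≃ₜ* SOStar 2,
            ∀ g : SU2 × SL2R, e (QuotientGroup.mk g) = Φ g := by
  refine ⟨.ofEquivFun suSlCoords, .ofEquivFun soStarCoords, fun θ => ?_, suSlLieEquiv,
    fun i => ?_, cover, exists_cover_eq_exp, isCoveringMap_cover,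
    cover_surjective, cover_preimage_ncard, cover_ker, fun g h => cover_eq_neg_one,
    quotientCoverEquiv, quotientCoverEquiv_mk⟩
  · rw [sum_smul_ofEquivFun, sum_smul_ofEquivFun]
    exact ⟨rfl, rfl, rfl⟩
  · rw [suSlLieEquiv_apply]
    simp [suSlEquiv]
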